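/- Setting. Let $n\in\mathbb N$, let $\mathcal X\subset\mathbb R^n$ and $\mathcal Y\subset\mathbb R$ be compact, and let $\Lambda$ be a probability distribution of pairs $(x,y)$ supported on $\mathcal X\times\mathcal Y$. Let $f(\cdot\,;\cdot)$ be a loss such that for every $y\in\mathcal Y$ the function $f_y=f(\cdot\,;y):\mathbb R\to\mathbb R$ is convex and differentiable with $L$-Lipschitz derivative ($L$ independent of $y$), and such that for every $z\in\mathbb R$ the function $y\mapsto f(z;y)$ is measurable and bounded on $\mathcal Y$. Let $f_y^*(\zeta)=\sup_{z\in\mathbb R}(\zeta z-f_y(z))\in(-\infty,+\infty]$ be the convex conjugate. Let $\Omega(\beta)=\sum_{g\in\mathcal G}\Omega_g(\beta_g)$, where $\mathcal G$ is a partition of $\{1,\dots,n\}$, $\beta_g$ is the restriction of $\beta$ to the coordinates in $g$, and each $\Omega_g$ is a norm on $\mathbb R^{g}$. Let $\lambda>0$ and $$\mathcal P(\beta)=\mathbb E_{(x,y)\sim\Lambda}\big[f(x^\top\beta;y)\big]+\lambda\,\Omega(\beta),\qquad \beta\in\mathbb R^n .$$ Online algorithm. Let $(\mathcal F_t)_{t\ge0}$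 be a filtration on a probability space. For each $t\ge1$ let the sample $(x_t,y_t)$ be $\mathcal F_t$-measurable, with law $\Lambda$ and independent of $\mathcal F_{t-1}$, and let the iterate $\beta_t\in\mathbb R^n$ be an $\mathcal F_{t-1}$-measurable random vector (for instance, $\mathcal F_t$ is generated by $(x_s,y_s)_{s\le t}$ and $\beta_t$ is computed from the first $t-1$ samples). Put $\theta_t=f_{y_t}'(x_t^\top\beta_t)$. Let $\mu_t\in(0,1)$ for $t\ge2$, with $\sum_t\mu_t=+\infty$ and $\sum_t\mu_t^2<\infty$. Define $\bar Z_1=-\frac1\lambda\theta_1x_1$, $\bar F^{(1)}(\beta)=f_{y_1}(x_1^\top\beta)$, $\bar D^{(1)}=-f_{y_1}^*(\theta_1)$ and, for $t\ge2$, $$\bar Z_t=-\tfrac1\lambda\mu_t\theta_tx_t+(1-\mu_t)\bar Z_{t-1},\qquad \bar F^{(t)}(\beta)=\mu_tf_{y_t}(x_t^\top\beta)+(1-\mu_t)\bar F^{(t-1)}(\beta),$$ $$\bar D^{(t)}=-\mu_tf_{y_t}^*(\theta_t)+(1-\mu_t)\bar D^{(t-1)},\qquad \mathrm{Gap}_t(\beta)=\bar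 F^{(t)}(\beta)+\lambda\,\Omega(\beta)-\bar D^{(t)} .$$ Proposition 3.2 (Convergence of the online estimate). Let $\beta^\star$ be a minimizer of $\mathcal P$ over $\mathbb R^n$, let $Z^\star=-\frac1\lambda\,\mathbb E_{(x,y)\sim\Lambda}\big[f_y'(x^\top\beta^\star)\,x\big]$, and assume that $\beta_t\to\beta^\star$ almost surely. Then, with probability 1, (i) $\bar Z_t\to Z^\star$ as $t\to\infty$; (ii) for every sequence $(\bar\beta_t)$ in $\mathbb R^n$ (possibly depending on the realization) with $\bar\beta_t\to\beta^\star$, $\mathrm{Gap}_t(\bar\beta_t)\to0$ as $t\to\infty$. -/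

import Mathlib

open Filter Topology MeasureTheory ProbabilityTheory

namespace OnlineScreening

/-- The assumptions on the loss `f z y = f(z; y) = f_y(z)` over the label set `𝒴`: for each label `y`,
`f_y` is convex and differentiable with `L`-Lipschitz derivative; for each `z`, the function
`y ↦ f(z; y)` is measurable and bounded on `𝒴`. -/
structure IsSmoothConvexLoss (f : ℝ → ℝ → ℝ) (𝒴 : Set ℝ) (L : NNReal) : Prop where
  convex : ∀ y ∈ 𝒴, ConvexOn ℝ Set.univ (fun z => f z y)
  differentiable : ∀ y ∈ 𝒴, Differentiable ℝ (fun z => f z y)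
  lipschitz_deriv : ∀ y ∈ 𝒴, LipschitzWith L (deriv (fun z => f z y))
  measurable : ∀ z, Measurable (fun y : 𝒴 => f z y)
  bounded : ∀ z, ∃ C, ∀ y ∈ 𝒴, |f z y| ≤ C

/-- A group decomposable norm on `ℝⁿ`: a partition of the coordinates into (nonempty) groups, and a
norm on `ℝ^g` for each group `g` (a seminorm that vanishes only at `0`). -/
structure GroupNorm (n : ℕ) where
  groups : Finpartition (Finset.univ : Finset (Fin n))
  groupNorm : ∀ g : groups.parts, Seminorm ℝ (g.1 → ℝ)
  definite : ∀ (g : groups.parts) (v : g.1 → ℝ), groupNorm g v = 0 → v = 0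

/-- `Ω(β) = ∑_g Ω_g(β_g)`. -/
noncomputable def GroupNorm.eval {n : ℕ} (R : GroupNorm n) (β : EuclideanSpace ℝ (Fin n)) : ℝ :=
  ∑ g : R.groups.parts, R.groupNorm g (fun i => β i)

/-- The convex conjugate `φ*(ζ) = sup_z (ζ z - φ(z))`, with values in `(-∞, +∞]`. -/
noncomputable def conjugate (φ : ℝ → ℝ) (ζ : ℝ) : EReal :=
  ⨆ z : ℝ, ((ζ * z - φ z : ℝ) : EReal)

variable {n : ℕ}

/-- The regularized population objective `𝒫(β) = 𝔼[f(xᵀβ; y)] + λ Ω(β)`. -/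
noncomputable def objective (f : ℝ → ℝ → ℝ) (Λ : Measure (EuclideanSpace ℝ (Fin n) × ℝ)) (lam : ℝ)
    (R : GroupNorm n) (β : EuclideanSpace ℝ (Fin n)) : ℝ :=
  ∫ p, f (inner ℝ p.1 β) p.2 ∂Λ + lam * R.eval β

/-- The dual certificate `Z⋆ = -(1/λ) 𝔼[f_y'(xᵀβ⋆) x]`. -/
noncomputable def certificate (f : ℝ → ℝ → ℝ) (Λ : Measure (EuclideanSpace ℝ (Fin n) × ℝ))
    (lam : ℝ) (βstar : EuclideanSpace ℝ (Fin n)) : EuclideanSpace ℝ (Fin n) :=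
  -(1 / lam) • ∫ p, deriv (fun z => f z p.2) (inner ℝ p.1 βstar) • p.1 ∂Λ

/-! The online quantities below depend on one realization of the samples `(x_t, y_t)` and of the
iterates `β_t`, `t ≥ 1`; the index `0` is never used, and the values given there are conventional. -/

/-- `θ_t = f_{y_t}'(x_tᵀ β_t)`. -/
noncomputable def onlineTheta (f : ℝ → ℝ → ℝ) (x : ℕ → EuclideanSpace ℝ (Fin n)) (y : ℕ → ℝ)
    (β : ℕ → EuclideanSpace ℝ (Fin n)) (t : ℕ) : ℝ :=
  deriv (fun z => f z (y t)) (inner ℝ (x t) (β t))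

/-- `Z̄_1 = -(1/λ) θ_1 x_1` and `Z̄_t = -(1/λ) μ_t θ_t x_t + (1 - μ_t) Z̄_{t-1}`. -/
noncomputable def onlineCertificate (f : ℝ → ℝ → ℝ) (lam : ℝ) (μ : ℕ → ℝ)
    (x : ℕ → EuclideanSpace ℝ (Fin n)) (y : ℕ → ℝ) (β : ℕ → EuclideanSpace ℝ (Fin n)) :
    ℕ → EuclideanSpace ℝ (Fin n)
  | 0 => 0
  | 1 => (-(1 / lam) * onlineTheta f x y β 1) • x 1
  | t + 2 => (-(1 / lam) * μ (t + 2) * onlineTheta f x y β (t + 2)) • x (t + 2) +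
      (1 - μ (t + 2)) • onlineCertificate f lam μ x y β (t + 1)

/-- `F̄^(1)(b) = f_{y_1}(x_1ᵀb)` and `F̄^(t)(b) = μ_t f_{y_t}(x_tᵀb) + (1 - μ_t) F̄^(t-1)(b)`. -/
noncomputable def onlineLoss (f : ℝ → ℝ → ℝ) (μ : ℕ → ℝ) (x : ℕ → EuclideanSpace ℝ (Fin n))
    (y : ℕ → ℝ) (b : EuclideanSpace ℝ (Fin n)) : ℕ → ℝ
  | 0 => 0
  | 1 => f (inner ℝ (x 1) b) (y 1)
  | t + 2 => μ (t + 2) * f (inner ℝ (x (t + 2)) b) (y (t + 2)) +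
      (1 - μ (t + 2)) * onlineLoss f μ x y b (t + 1)

/-- The online primal objective `P̄^(t)(b) = F̄^(t)(b) + λ Ω(b)`. -/
noncomputable def onlinePrimal (f : ℝ → ℝ → ℝ) (lam : ℝ) (R : GroupNorm n) (μ : ℕ → ℝ)
    (x : ℕ → EuclideanSpace ℝ (Fin n)) (y : ℕ → ℝ) (t : ℕ) (b : EuclideanSpace ℝ (Fin n)) : ℝ :=
  onlineLoss f μ x y b t + lam * R.eval b

/-- The online dual objective, with values in `[-∞, +∞)`: `D̄^(1)(ζ_1) = -f_{y_1}*(ζ_1)` and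
`D̄^(t)(ζ_1, …, ζ_t) = -μ_t f_{y_t}*(ζ_t) + (1 - μ_t) D̄^(t-1)(ζ_1, …, ζ_{t-1})`. -/
noncomputable def onlineDual (f : ℝ → ℝ → ℝ) (μ : ℕ → ℝ) (y : ℕ → ℝ) (ζ : ℕ → ℝ) : ℕ → EReal
  | 0 => 0
  | 1 => -conjugate (fun z => f z (y 1)) (ζ 1)
  | t + 2 => -((μ (t + 2) : EReal) * conjugate (fun z => f z (y (t + 2))) (ζ (t + 2))) +
      ((1 - μ (t + 2) : ℝ) : EReal) * onlineDual f μ y ζ (t + 1)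

/-- The online duality gap `Gap_t(b) = P̄^(t)(b) - D̄^(t)(θ_1, …, θ_t)`. -/
noncomputable def onlineGap (f : ℝ → ℝ → ℝ) (lam : ℝ) (R : GroupNorm n) (μ : ℕ → ℝ)
    (x : ℕ → EuclideanSpace ℝ (Fin n)) (y : ℕ → ℝ) (β : ℕ → EuclideanSpace ℝ (Fin n))
    (t : ℕ) (b : EuclideanSpace ℝ (Fin n)) : EReal :=
  (onlinePrimal f lam R μ x y t b : EReal) - onlineDual f μ y (onlineTheta f x y β) t

/-- The online sampling model: at each step `t ≥ 1` the sample `(x_t, y_t)` is drawn from `Λ`,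
independently of the past `ℱ_{t-1}`, and the iterate `β_t` is determined by that past. (The past
`ℱ_t` contains the samples up to time `t`, and may contain additional randomness of the algorithm.)
In particular the samples are i.i.d. with law `Λ`. -/
structure IsOnlineScheme {S : Type*} [mS : MeasurableSpace S] (P : Measure S) (ℱ : Filtration ℕ mS)
    (Λ : Measure (EuclideanSpace ℝ (Fin n) × ℝ)) (x : ℕ → S → EuclideanSpace ℝ (Fin n))
    (y : ℕ → S → ℝ) (β : ℕ → S → EuclideanSpace ℝ (Fin n)) : Prop where
  measurable_sample : ∀ t, Measurable[ℱ (t + 1)] (fun ω => (x (t + 1) ω, y (t + 1) ω))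
  law : ∀ t, P.map (fun ω => (x (t + 1) ω, y (t + 1) ω)) = Λ
  indep_past : ∀ t, Indep
    (MeasurableSpace.comap (fun ω => (x (t + 1) ω, y (t + 1) ω)) inferInstance) (ℱ t) P
  measurable_iterate : ∀ t, Measurable[ℱ t] (β (t + 1))

end OnlineScreening

namespace OnlineScreening

/-! All online quantities are running averages with weights `μ_t`. For a fixed bounded function of
the sample, such averages converge almost surely to the mean. Each sample is independent of the
past, so the weighted centered sums form a martingale, bounded in L² because `∑ μ_t²` is finite; `∑
μ_t = ∞` then turns convergence of this series into convergence of the averages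
(`tendsto_runningAverage_of_series`, `IsOnlineScheme.ae_tendsto_runningAverage`).

This law of large numbers is applied to functions evaluated at `βstar`. Samples are bounded, and the
loss and its derivative are Lipschitz on bounded intervals uniformly in the label, so replacing
`βstar` by `β_t` perturbs the averaged terms by o(1), which does not affect the limit
(`tendsto_runningAverage_of_sub`). This settles the certificate.

For the gap, equality in Fenchel's inequality (`conjugate_deriv`) makes the dual value a running
average of f - f'·⟨x, β_t⟩. Stationarity of the objective along the ray through `βstar`
(`integral_deriv_mul_add_eval_eq_zero`) gives 𝔼[f'·⟨x, β⋆⟩] = -λ Ω(β⋆), so the dual limit equals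
𝒫(β⋆), which is also the primal limit. -/

/-- The running average `a_1 = u_1`, `a_t = μ_t u_t + (1 - μ_t) a_{t-1}`. -/
noncomputable def runningAverage {E : Type*} [AddCommGroup E] [Module ℝ E] (μ : ℕ → ℝ) (u : ℕ → E) :
    ℕ → E
  | 0 => 0
  | 1 => u 1
  | t + 2 => μ (t + 2) • u (t + 2) + (1 - μ (t + 2)) • runningAverage μ u (t + 1)

/-! ### Deterministic properties of running averages. -/

section Averaging

variable {E : Type*} [NormedAddCommGroup E] [NormedSpace ℝ E] {μ : ℕ → ℝ}

/-- A nonnegative sequence contracted by the factors `1 - μ_t` up to errors `μ_t b_t`, `b_t → 0`,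
tends to `0` as soon as `∑ μ_t = ∞`. -/
theorem tendsto_zero_of_contraction (hμ : ∀ t, 2 ≤ t → μ t ∈ Set.Ioo (0 : ℝ) 1)
    (hμ_sum : Tendsto (fun T => ∑ t ∈ Finset.Icc 1 T, μ t) atTop atTop)
    {a b : ℕ → ℝ} (ha : ∀ t, 0 ≤ a t) (hb : Tendsto b atTop (𝓝 0))
    (hab : ∀ t, 1 ≤ t → a (t + 1) ≤ (1 - μ (t + 1)) * a t + μ (t + 1) * b t) :
    Tendsto a atTop (𝓝 0) := by
  rw [Metric.tendsto_atTop]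
  intro ε hε
  obtain ⟨T₀, hT₀⟩ := eventually_atTop.1 (hb.eventually_lt_const (half_pos hε))
  set T := max T₀ 1
  -- After `T` the errors are below `ε / 2`, so `a t - ε / 2` is contracted by the factors `1 - μ`;
  -- each is at most exp(-μ), and the difference of sums is minus the weight accumulated since `T`.
  have key : ∀ t, T ≤ t → a t - ε / 2 ≤
      a T * Real.exp (∑ s ∈ Finset.Icc 1 T, μ s - ∑ s ∈ Finset.Icc 1 t, μ s) := by
    intro t ht
    induction t, ht using Nat.le_induction with
    | base => simp; positivity
    | succ t ht ih =>
      have h1 : 1 ≤ t := (le_max_right _ _).trans ht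
      obtain ⟨h0, h1'⟩ := hμ (t + 1) (by omega)
      have hbt := hT₀ t ((le_max_left _ _).trans ht)
      rw [Finset.sum_Icc_succ_top (by omega), ← sub_sub, sub_eq_add_neg _ (μ (t + 1)), Real.exp_add]
      have hexp : 1 - μ (t + 1) ≤ Real.exp (-μ (t + 1)) := by
        linarith [Real.add_one_le_exp (-μ (t + 1))]
      set e := Real.exp (∑ s ∈ Finset.Icc 1 T, μ s - ∑ s ∈ Finset.Icc 1 t, μ s)
      have he : 0 ≤ a T * e := mul_nonneg (ha T) (Real.exp_pos _).le
      calc a (t + 1) - ε / 2 ≤ (1 - μ (t + 1)) * (a t - ε / 2) := by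
            nlinarith [hab t h1, mul_lt_mul_of_pos_left hbt h0]
        _ ≤ (1 - μ (t + 1)) * (a T * e) := mul_le_mul_of_nonneg_left ih (by linarith)
        _ ≤ Real.exp (-μ (t + 1)) * (a T * e) := mul_le_mul_of_nonneg_right hexp he
        _ = _ := by ring
  have hlim : Tendsto (fun t => a T *
      Real.exp (∑ s ∈ Finset.Icc 1 T, μ s - ∑ s ∈ Finset.Icc 1 t, μ s)) atTop (𝓝 0) := by
    rw [← mul_zero (a T)]
    exact (Real.tendsto_exp_atBot.comp
      (tendsto_atBot_add_const_left _ _ (tendsto_neg_atTop_atBot.comp hμ_sum))).const_mul _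
  obtain ⟨N, hN⟩ := eventually_atTop.1 (hlim.eventually_lt_const (half_pos hε))
  refine ⟨max N T, fun t ht => ?_⟩
  rw [Real.dist_0_eq_abs, abs_of_nonneg (ha t)]
  linarith [key t ((le_max_right _ _).trans ht), hN t ((le_max_left _ _).trans ht)]

/-- The distance to `l` contracts up to errors `μ_t ‖c_t - l‖`, so the scalar case applies. -/
theorem tendsto_of_averaging (hμ : ∀ t, 2 ≤ t → μ t ∈ Set.Ioo (0 : ℝ) 1)
    (hμ_sum : Tendsto (fun T => ∑ t ∈ Finset.Icc 1 T, μ t) atTop atTop)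
    {h c : ℕ → E} {l : E} (hc : Tendsto c atTop (𝓝 l))
    (hh : ∀ t, 1 ≤ t → h (t + 1) = (1 - μ (t + 1)) • h t + μ (t + 1) • c t) :
    Tendsto h atTop (𝓝 l) := by
  rw [tendsto_iff_norm_sub_tendsto_zero] at hc ⊢
  refine tendsto_zero_of_contraction hμ hμ_sum (fun _ => norm_nonneg _) hc fun t ht => ?_
  obtain ⟨h0, h1⟩ := hμ (t + 1) (by omega)
  have : h (t + 1) - l = (1 - μ (t + 1)) • (h t - l) + μ (t + 1) • (c t - l) := by
    rw [hh t ht]; module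
  rw [this]
  refine (norm_add_le _ _).trans_eq ?_
  rw [norm_smul, norm_smul, Real.norm_of_nonneg h0.le, Real.norm_of_nonneg (by linarith)]

theorem runningAverage_succ (u : ℕ → E) {t : ℕ} (ht : 1 ≤ t) :
    runningAverage μ u (t + 1) =
      μ (t + 1) • u (t + 1) + (1 - μ (t + 1)) • runningAverage μ u t := by
  obtain ⟨t, rfl⟩ : ∃ s, t = s + 1 := ⟨t - 1, by omega⟩
  rfl

theorem runningAverage_congr {u v : ℕ → E} (h : ∀ t, 1 ≤ t → u t = v t) (t : ℕ) :
    runningAverage μ u t = runningAverage μ v t := by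
  induction t with
  | zero => rfl
  | succ t ih =>
    rcases Nat.eq_zero_or_pos t with rfl | ht
    · exact h 1 le_rfl
    · rw [runningAverage_succ _ ht, runningAverage_succ _ ht, ih, h _ (by omega)]

theorem runningAverage_map {F : Type*} [NormedAddCommGroup F] [NormedSpace ℝ F] (A : E →ₗ[ℝ] F)
    (u : ℕ → E) (t : ℕ) :
    A (runningAverage μ u t) = runningAverage μ (fun s => A (u s)) t := by
  induction t with
  | zero => exact map_zero A
  | succ t ih =>
    rcases Nat.eq_zero_or_pos t with rfl | ht
    · rfl
    · rw [runningAverage_succ _ ht, runningAverage_succ _ ht, map_add, map_smul, map_smul, ih]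

theorem runningAverage_add (u v : ℕ → E) (t : ℕ) :
    runningAverage μ (fun s => u s + v s) t = runningAverage μ u t + runningAverage μ v t := by
  induction t with
  | zero => exact (add_zero _).symm
  | succ t ih =>
    rcases Nat.eq_zero_or_pos t with rfl | ht
    · rfl
    · simp only [runningAverage_succ _ ht, ih]; module

theorem norm_runningAverage_le (hμ : ∀ t, 2 ≤ t → μ t ∈ Set.Ioo (0 : ℝ) 1) {u : ℕ → E} {C : ℝ}
    (hC : 0 ≤ C) (hu : ∀ t, 1 ≤ t → ‖u t‖ ≤ C) (t : ℕ) : ‖runningAverage μ u t‖ ≤ C := by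
  induction t with
  | zero => simpa [runningAverage] using hC
  | succ t ih =>
    rcases Nat.eq_zero_or_pos t with rfl | ht
    · exact hu 1 le_rfl
    · obtain ⟨h0, h1⟩ := hμ (t + 1) (by omega)
      rw [runningAverage_succ _ ht]
      refine (norm_add_le _ _).trans ?_
      rw [norm_smul, norm_smul, Real.norm_of_nonneg h0.le, Real.norm_of_nonneg (by linarith)]
      nlinarith [mul_le_mul_of_nonneg_left (hu (t + 1) (by omega)) h0.le]

theorem tendsto_runningAverage (hμ : ∀ t, 2 ≤ t → μ t ∈ Set.Ioo (0 : ℝ) 1)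
    (hμ_sum : Tendsto (fun T => ∑ t ∈ Finset.Icc 1 T, μ t) atTop atTop)
    {u : ℕ → E} {l : E} (hu : Tendsto u atTop (𝓝 l)) :
    Tendsto (runningAverage μ u) atTop (𝓝 l) :=
  tendsto_of_averaging hμ hμ_sum ((tendsto_add_atTop_iff_nat 1).2 hu) fun t ht => by
    rw [runningAverage_succ _ ht, add_comm]

/-- Running averages of asymptotically equal sequences have the same limit. -/
theorem tendsto_runningAverage_of_sub (hμ : ∀ t, 2 ≤ t → μ t ∈ Set.Ioo (0 : ℝ) 1)
    (hμ_sum : Tendsto (fun T => ∑ t ∈ Finset.Icc 1 T, μ t) atTop atTop)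
    {u v : ℕ → E} {l : E} (hv : Tendsto (runningAverage μ v) atTop (𝓝 l))
    (huv : Tendsto (fun t => u t - v t) atTop (𝓝 0)) :
    Tendsto (runningAverage μ u) atTop (𝓝 l) := by
  have h := hv.add (tendsto_runningAverage hμ hμ_sum huv)
  rw [add_zero] at h
  refine h.congr fun t => ?_
  rw [← runningAverage_add]
  simp

/-- If `∑ μ_t (u_t - l)` converges, the running averages of `u` tend to `l`. -/
theorem tendsto_runningAverage_of_series (hμ : ∀ t, 2 ≤ t → μ t ∈ Set.Ioo (0 : ℝ) 1)
    (hμ_sum : Tendsto (fun T => ∑ t ∈ Finset.Icc 1 T, μ t) atTop atTop)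
    {u : ℕ → E} {l s : E}
    (hs : Tendsto (fun T => ∑ t ∈ Finset.range T, μ (t + 1) • (u (t + 1) - l)) atTop (𝓝 s)) :
    Tendsto (runningAverage μ u) atTop (𝓝 l) := by
  set M : ℕ → E := fun T => ∑ t ∈ Finset.range T, μ (t + 1) • (u (t + 1) - l) with hM
  -- Subtracting the partial sums cancels the noise: the difference is itself a running average, of
  -- the convergent sequence `l - M t`.
  have key : Tendsto (fun t => runningAverage μ u t - M t) atTop (𝓝 (l - s)) := by
    refine tendsto_of_averaging hμ hμ_sum (hs.const_sub l) fun t ht => ?_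
    rw [runningAverage_succ _ ht, hM]
    simp only [Finset.sum_range_succ]
    module
  simpa using key.add hs

end Averaging

/-! ### Almost sure convergence of martingale series. -/

section StochasticSeries

variable {S : Type*} [mS : MeasurableSpace S] {P : Measure S} [IsProbabilityMeasure P]
  {ℱ : Filtration ℕ mS}

/-- A series of bounded, centered innovations with square summable weights converges a.s. -/
theorem ae_tendsto_series_of_innovation {X : ℕ → S → ℝ} (hX : ∀ t, Measurable[ℱ (t + 1)] (X t))
    {C : ℝ} (hC : ∀ t ω, |X t ω| ≤ C)
    (hind : ∀ t, Indep (MeasurableSpace.comap (X t) inferInstance) (ℱ t) P)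
    (hmean : ∀ t, ∫ ω, X t ω ∂P = 0) {a : ℕ → ℝ} (ha : Summable fun t => a t ^ 2) :
    ∀ᵐ ω ∂P, ∃ s, Tendsto (fun T => ∑ t ∈ Finset.range T, a t * X t ω) atTop (𝓝 s) := by
  set M : ℕ → S → ℝ := fun T ω => ∑ t ∈ Finset.range T, a t * X t ω with hMdef
  have hXm : ∀ t, Measurable (X t) := fun t => (hX t).mono (ℱ.le _) le_rfl
  have hMm : ∀ T, Measurable[ℱ T] (M T) := fun T =>
    Finset.measurable_fun_sum _ fun t ht =>
      ((hX t).mono (ℱ.mono (Finset.mem_range.1 ht)) le_rfl).const_mul _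
  have hMm' : ∀ T, Measurable (M T) := fun T => (hMm T).mono (ℱ.le _) le_rfl
  have hMb : ∀ T ω, |M T ω| ≤ ∑ t ∈ Finset.range T, |a t| * C := fun T ω =>
    (Finset.abs_sum_le_sum_abs _ _).trans <| Finset.sum_le_sum fun t _ => by
      rw [abs_mul]; exact mul_le_mul_of_nonneg_left (hC t ω) (abs_nonneg _)
  have hMsucc : ∀ T ω, M (T + 1) ω = M T ω + a T * X T ω := fun T ω => Finset.sum_range_succ _ _
  have int_of_bdd : ∀ {g : S → ℝ} (K : ℝ), Measurable g → (∀ ω, |g ω| ≤ K) → Integrable g P :=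
    fun K hg hK => Integrable.of_bound hg.aestronglyMeasurable K (ae_of_all _ hK)
  have hXint : ∀ t, Integrable (X t) P := fun t => int_of_bdd C (hXm t) (hC t)
  have hMint : ∀ T, Integrable (M T) P := fun T => int_of_bdd _ (hMm' T) (hMb T)
  have hmart : Martingale M ℱ P := by
    refine martingale_of_condExp_sub_eq_zero_nat (fun T => (hMm T).stronglyMeasurable) hMint
      fun T => ?_
    have h1 : M (T + 1) - M T = a T • X T := by
      ext ω; simp [hMsucc]
    rw [h1]
    -- By independence from the past, the conditional expectation of the increment is its mean,
    -- which is zero.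
    have h2 := condExp_indep_eq (μ := P) (hXm T).comap_le (ℱ.le T)
      (comap_measurable (X T)).stronglyMeasurable (hind T)
    filter_upwards [condExp_smul (μ := P) (a T) (X T) (ℱ T), h2] with ω h3 h4
    rw [h3, Pi.smul_apply, h4, hmean]
    simp
  have hXsq : ∀ t, ∫ ω, X t ω ^ 2 ∂P ≤ C ^ 2 := fun t => by
    have : ∫ ω, X t ω ^ 2 ∂P ≤ ∫ _, C ^ 2 ∂P :=
      integral_mono_of_nonneg (ae_of_all _ fun ω => sq_nonneg _) (integrable_const _)
        (ae_of_all _ fun ω => sq_le_sq' (abs_le.1 (hC t ω)).1 (abs_le.1 (hC t ω)).2)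
    simpa using this
  -- Orthogonality of increments: the cross term vanishes since `X T` is centered and independent of
  -- `M T`.
  have hsq : ∀ T, ∫ ω, M T ω ^ 2 ∂P ≤ ∑ t ∈ Finset.range T, a t ^ 2 * C ^ 2 := by
    intro T
    induction T with
    | zero => simp [hMdef]
    | succ T ih =>
      have hI : IndepFun (X T) (M T) P := by
        rw [IndepFun_iff_Indep]
        exact indep_of_indep_of_le_right (hind T) (hMm T).comap_le
      have hcross : ∫ ω, X T ω * M T ω ∂P = 0 := by
        rw [hI.integral_fun_mul_eq_mul_integral (hXm T).aestronglyMeasurable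
          (hMm' T).aestronglyMeasurable, hmean, zero_mul]
      have hi1 : Integrable (fun ω => M T ω ^ 2) P :=
        int_of_bdd ((∑ t ∈ Finset.range T, |a t| * C) ^ 2) ((hMm' T).pow_const 2) fun ω => by
          rw [abs_pow]; exact pow_le_pow_left₀ (abs_nonneg _) (hMb T ω) 2
      have hi2 : Integrable (fun ω => X T ω ^ 2) P :=
        int_of_bdd (C ^ 2) ((hXm T).pow_const 2) fun ω => by
          rw [abs_pow]; exact pow_le_pow_left₀ (abs_nonneg _) (hC T ω) 2
      have hi3 : Integrable (fun ω => X T ω * M T ω) P :=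
        int_of_bdd (C * ∑ t ∈ Finset.range T, |a t| * C) ((hXm T).mul (hMm' T)) fun ω => by
          rw [abs_mul]
          exact mul_le_mul (hC T ω) (hMb T ω) (abs_nonneg _) ((abs_nonneg _).trans (hC T ω))
      have hexp : ∀ ω, M (T + 1) ω ^ 2 =
          M T ω ^ 2 + 2 * a T * (X T ω * M T ω) + a T ^ 2 * X T ω ^ 2 := fun ω => by
        rw [hMsucc]; ring
      simp only [hexp]
      have hi4 : Integrable (fun ω => M T ω ^ 2 + 2 * a T * (X T ω * M T ω)) P :=
        hi1.add (hi3.const_mul _)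
      rw [integral_add hi4 (hi2.const_mul _), integral_add hi1 (hi3.const_mul _),
        integral_const_mul, integral_const_mul, hcross,
        Finset.sum_range_succ, mul_zero, add_zero]
      exact add_le_add ih (mul_le_mul_of_nonneg_left (hXsq T) (sq_nonneg _))
  -- The L² bound yields an L¹ bound through |m| ≤ 1 + m², as required by the martingale convergence
  -- theorem.
  set B : ℝ := 1 + ∑' t, a t ^ 2 * C ^ 2
  have hL1 : ∀ T, eLpNorm (M T) 1 P ≤ (B.toNNReal : ENNReal) := by
    intro T
    rw [eLpNorm_one_eq_lintegral_enorm, ← ofReal_integral_norm_eq_lintegral_enorm (hMint T)]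
    refine ENNReal.ofReal_le_ofReal ?_
    have hi1 : Integrable (fun ω => M T ω ^ 2) P :=
      int_of_bdd ((∑ t ∈ Finset.range T, |a t| * C) ^ 2) ((hMm' T).pow_const 2) fun ω => by
        rw [abs_pow]; exact pow_le_pow_left₀ (abs_nonneg _) (hMb T ω) 2
    calc ∫ ω, ‖M T ω‖ ∂P ≤ ∫ ω, (1 + M T ω ^ 2) ∂P := by
          refine integral_mono (hMint T).norm ((integrable_const _).add hi1) fun ω => ?_
          rw [Real.norm_eq_abs]
          nlinarith [sq_abs (M T ω), sq_nonneg (|M T ω| - 1), abs_nonneg (M T ω)]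
      _ = 1 + ∫ ω, M T ω ^ 2 ∂P := by
          rw [integral_add (integrable_const _) hi1]; simp
      _ ≤ B := by
          refine add_le_add le_rfl ((hsq T).trans ?_)
          exact (ha.mul_right _).sum_le_tsum _ fun t _ => by positivity
  exact hmart.submartingale.exists_ae_tendsto_of_bdd hL1

end StochasticSeries

/-! ### Weighted law of large numbers for the samples. -/

section LawOfLargeNumbers

variable {n : ℕ} {S : Type*} [mS : MeasurableSpace S] {P : Measure S}
  {ℱ : Filtration ℕ mS} {Λ : Measure (EuclideanSpace ℝ (Fin n) × ℝ)}
  {x : ℕ → S → EuclideanSpace ℝ (Fin n)} {y : ℕ → S → ℝ} {β : ℕ → S → EuclideanSpace ℝ (Fin n)}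
  {μ : ℕ → ℝ}

theorem IsOnlineScheme.measurable_pair (h : IsOnlineScheme P ℱ Λ x y β) (t : ℕ) :
    Measurable (fun ω => (x (t + 1) ω, y (t + 1) ω)) :=
  (h.measurable_sample t).mono (ℱ.le _) le_rfl

/-- A property that holds `Λ`-a.e. holds a.s. for all samples at once. -/
theorem IsOnlineScheme.ae_forall_sample (h : IsOnlineScheme P ℱ Λ x y β)
    {p : EuclideanSpace ℝ (Fin n) × ℝ → Prop} (hp : ∀ᵐ q ∂Λ, p q) :
    ∀ᵐ ω ∂P, ∀ t, 1 ≤ t → p (x t ω, y t ω) := by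
  have : ∀ᵐ ω ∂P, ∀ t, p (x (t + 1) ω, y (t + 1) ω) := by
    rw [ae_all_iff]
    intro t
    refine ae_of_ae_map (h.measurable_pair t).aemeasurable ?_
    rw [h.law t]
    exact hp
  filter_upwards [this] with ω hω t ht
  obtain ⟨t, rfl⟩ : ∃ s, t = s + 1 := ⟨t - 1, by omega⟩
  exact hω t

theorem IsOnlineScheme.ae_tendsto_runningAverage_of_measurable [IsProbabilityMeasure P]
    [IsProbabilityMeasure Λ] (h : IsOnlineScheme P ℱ Λ x y β)
    (hμ : ∀ t, 2 ≤ t → μ t ∈ Set.Ioo (0 : ℝ) 1)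
    (hμ_sum : Tendsto (fun T => ∑ t ∈ Finset.Icc 1 T, μ t) atTop atTop)
    (hμ_sq : Summable (fun t => μ t ^ 2)) {g : EuclideanSpace ℝ (Fin n) × ℝ → ℝ}
    (hg : Measurable g) {C : ℝ} (hC : ∀ p, |g p| ≤ C) :
    ∀ᵐ ω ∂P, Tendsto (runningAverage μ fun t => g (x t ω, y t ω)) atTop (𝓝 (∫ p, g p ∂Λ)) := by
  set m := ∫ p, g p ∂Λ
  have hgi : Integrable g Λ := Integrable.of_bound hg.aestronglyMeasurable C (ae_of_all _ hC)
  have hg' : Measurable fun p => g p - m := hg.sub_const m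
  -- The shift by one makes `ℱ t` the past of the innovation `X t`, which is built from sample `t +
  -- 1`.
  have := ae_tendsto_series_of_innovation (P := P) (ℱ := ℱ)
    (X := fun t ω => g (x (t + 1) ω, y (t + 1) ω) - m) (C := C + |m|) (a := fun t => μ (t + 1))
    (fun t => hg'.comp (h.measurable_sample t))
    (fun t ω => (abs_sub _ _).trans (add_le_add (hC _) le_rfl))
    (fun t => indep_of_indep_of_le_left (h.indep_past t) (by
      rintro _ ⟨s, hs, rfl⟩
      exact ⟨_, hg' hs, rfl⟩))
    (fun t => by
      have h1 := integral_map (μ := P) (h.measurable_pair t).aemeasurable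
        (f := fun p => g p - m) hg'.aestronglyMeasurable
      rw [← h1, h.law t, integral_sub hgi (integrable_const _)]
      simp [m])
    ((summable_nat_add_iff 1).2 hμ_sq)
  filter_upwards [this] with ω ⟨s, hs⟩
  exact tendsto_runningAverage_of_series hμ hμ_sum (u := fun t => g (x t ω, y t ω)) (l := m) hs

/-- The weighted law of large numbers for the samples of an online scheme. -/
theorem IsOnlineScheme.ae_tendsto_runningAverage [IsProbabilityMeasure P]
    [IsProbabilityMeasure Λ] (h : IsOnlineScheme P ℱ Λ x y β)
    (hμ : ∀ t, 2 ≤ t → μ t ∈ Set.Ioo (0 : ℝ) 1)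
    (hμ_sum : Tendsto (fun T => ∑ t ∈ Finset.Icc 1 T, μ t) atTop atTop)
    (hμ_sq : Summable (fun t => μ t ^ 2)) {g : EuclideanSpace ℝ (Fin n) × ℝ → ℝ}
    (hg : AEMeasurable g Λ) {C : ℝ} (hC : ∀ᵐ p ∂Λ, |g p| ≤ C) :
    ∀ᵐ ω ∂P, Tendsto (runningAverage μ fun t => g (x t ω, y t ω)) atTop (𝓝 (∫ p, g p ∂Λ)) := by
  obtain ⟨p₀, hp₀⟩ := hC.exists
  have hC0 : 0 ≤ C := (abs_nonneg _).trans hp₀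
  -- Truncating a measurable version gives a function that is measurable and bounded everywhere,
  -- equal to `g` almost everywhere.
  set g' : EuclideanSpace ℝ (Fin n) × ℝ → ℝ := fun p => max (-C) (min C (hg.mk g p))
  have hg'm : Measurable g' := measurable_const.max (measurable_const.min hg.measurable_mk)
  have hgg' : g =ᵐ[Λ] g' := by
    filter_upwards [hC, hg.ae_eq_mk] with p hp hp'
    simp only [g', ← hp']
    rw [min_eq_right (abs_le.1 hp).2, max_eq_right (abs_le.1 hp).1]
  have hg'C : ∀ p, |g' p| ≤ C := fun p =>
    abs_le.2 ⟨le_max_left _ _, max_le (by linarith) (min_le_left _ _)⟩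
  filter_upwards [h.ae_tendsto_runningAverage_of_measurable hμ hμ_sum hμ_sq hg'm hg'C,
    h.ae_forall_sample hgg'] with ω hω hω'
  rw [integral_congr_ae hgg']
  exact hω.congr fun t => (runningAverage_congr hω' t).symm

theorem IsOnlineScheme.ae_tendsto_runningAverage_vector [IsProbabilityMeasure P]
    [IsProbabilityMeasure Λ] (h : IsOnlineScheme P ℱ Λ x y β)
    (hμ : ∀ t, 2 ≤ t → μ t ∈ Set.Ioo (0 : ℝ) 1)
    (hμ_sum : Tendsto (fun T => ∑ t ∈ Finset.Icc 1 T, μ t) atTop atTop)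
    (hμ_sq : Summable (fun t => μ t ^ 2))
    {g : EuclideanSpace ℝ (Fin n) × ℝ → EuclideanSpace ℝ (Fin n)}
    (hg : AEMeasurable g Λ) {C : ℝ} (hC : ∀ᵐ p ∂Λ, ‖g p‖ ≤ C) :
    ∀ᵐ ω ∂P, Tendsto (runningAverage μ fun t => g (x t ω, y t ω)) atTop (𝓝 (∫ p, g p ∂Λ)) := by
  have hgi : Integrable g Λ := Integrable.of_bound hg.aestronglyMeasurable C hC
  have hcoord : ∀ᵐ ω ∂P, ∀ i, Tendsto (runningAverage μ fun t => g (x t ω, y t ω) i) atTop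
      (𝓝 (∫ p, g p i ∂Λ)) := by
    rw [ae_all_iff]
    intro i
    refine h.ae_tendsto_runningAverage hμ hμ_sum hμ_sq (g := fun p => g p i) (C := C)
      ((EuclideanSpace.proj (𝕜 := ℝ) i).continuous.measurable.comp_aemeasurable hg) ?_
    filter_upwards [hC] with p hp
    exact (PiLp.norm_apply_le (g p) i).trans hp
  filter_upwards [hcoord] with ω hω
  rw [(PiLp.homeomorph 2 (fun _ : Fin n => ℝ)).isInducing.tendsto_nhds_iff, tendsto_pi_nhds]
  intro i
  have h1 : ∫ p, g p i ∂Λ = (∫ p, g p ∂Λ) i :=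
    (EuclideanSpace.proj (𝕜 := ℝ) i).integral_comp_comm hgi
  have h2 := hω i
  rw [h1] at h2
  exact h2.congr fun t =>
    (runningAverage_map (EuclideanSpace.proj (𝕜 := ℝ) i).toLinearMap _ t).symm

end LawOfLargeNumbers

/-! ### Measurability, uniform bounds and conjugate of the loss. -/

section Loss

variable {f : ℝ → ℝ → ℝ} {𝒴 : Set ℝ} {L : NNReal}

/-- Extending the loss by `0` outside the label set. -/
theorem IsSmoothConvexLoss.indicator (hf : IsSmoothConvexLoss f 𝒴 L) (h𝒴 : MeasurableSet 𝒴) :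
    (∀ y, Differentiable ℝ fun z => 𝒴.indicator (f z) y) ∧
      ∀ z, Measurable (𝒴.indicator (f z)) := by
  refine ⟨fun y => ?_, fun z => ?_⟩
  · by_cases hy : y ∈ 𝒴
    · simpa [hy] using hf.differentiable y hy
    · simp [hy]
  · refine measurable_of_restrict_of_restrict_compl h𝒴 ?_ ?_
    · have : 𝒴.domRestrict (𝒴.indicator (f z)) = fun y : 𝒴 => f z y := by
        ext y; exact Set.indicator_of_mem y.2 _
      rw [this]
      exact hf.measurable z
    · have : 𝒴ᶜ.domRestrict (𝒴.indicator (f z)) = fun _ => 0 := by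
        ext y; exact Set.indicator_of_notMem y.2 _
      rw [this]
      exact measurable_const

/-- A Carathéodory function, continuous in `z` and measurable in `y`, is jointly measurable. -/
theorem IsSmoothConvexLoss.measurable_uncurry_indicator (hf : IsSmoothConvexLoss f 𝒴 L)
    (h𝒴 : MeasurableSet 𝒴) : Measurable fun q : ℝ × ℝ => 𝒴.indicator (f q.1) q.2 :=
  measurable_uncurry_of_continuous_of_measurable (u := fun z y => 𝒴.indicator (f z) y)
    (fun y => ((hf.indicator h𝒴).1 y).continuous) (hf.indicator h𝒴).2

/-- The derivative is a pointwise limit of difference quotients along a fixed sequence of steps. -/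
theorem IsSmoothConvexLoss.measurable_deriv_indicator (hf : IsSmoothConvexLoss f 𝒴 L)
    (h𝒴 : MeasurableSet 𝒴) :
    Measurable fun q : ℝ × ℝ => deriv (fun z => 𝒴.indicator (f z) q.2) q.1 := by
  have hm := hf.measurable_uncurry_indicator h𝒴
  set u : ℕ → ℝ := fun k => 1 / ((k : ℝ) + 1)
  have hu0 : ∀ k, u k ≠ 0 := fun k => by positivity
  have hu : Tendsto u atTop (𝓝[≠] 0) := tendsto_nhdsWithin_iff.2
    ⟨tendsto_one_div_add_atTop_nhds_zero_nat, Eventually.of_forall hu0⟩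
  refine measurable_of_tendsto_metrizable (f := fun k (q : ℝ × ℝ) =>
    (u k)⁻¹ • (𝒴.indicator (f (q.1 + u k)) q.2 - 𝒴.indicator (f q.1) q.2)) (fun k => ?_) ?_
  · have h1 : Measurable fun q : ℝ × ℝ => 𝒴.indicator (f (q.1 + u k)) q.2 :=
      hm.comp ((measurable_fst.add_const (u k)).prodMk measurable_snd)
    exact (h1.sub hm).const_mul (u k)⁻¹
  · rw [tendsto_pi_nhds]
    intro q
    exact (hasDerivAt_iff_tendsto_slope_zero.1 ((hf.indicator h𝒴).1 q.2 q.1).hasDerivAt).comp hu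

/-- Uniform bounds for the loss, its derivative and its increments on bounded intervals. -/
theorem IsSmoothConvexLoss.exists_bound (hf : IsSmoothConvexLoss f 𝒴 L) (r : ℝ) :
    ∃ K, 0 ≤ K ∧ ∀ y ∈ 𝒴, ∀ z, |z| ≤ r →
      |f z y| ≤ K ∧ |deriv (fun z => f z y) z| ≤ K ∧ ∀ w, |w| ≤ r → |f z y - f w y| ≤ K * |z - w| := by
  obtain ⟨C₀, hC₀⟩ := hf.bounded 0
  obtain ⟨C₁, hC₁⟩ := hf.bounded 1
  obtain ⟨C₂, hC₂⟩ := hf.bounded (-1)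
  -- By convexity the derivative at 0 lies between the slopes over [-1, 0] and [0, 1], which the
  -- bounds at -1, 0, 1 control uniformly in `y`; the Lipschitz derivative adds `L * |r|`.
  set D : ℝ := |C₀| + |C₁| + |C₂| + L * |r| with hD
  have hD0 : 0 ≤ D := by positivity
  have hderiv : ∀ y ∈ 𝒴, ∀ z, |z| ≤ r → |deriv (fun z => f z y) z| ≤ D := by
    intro y hy z hz
    have hd := hf.differentiable y hy 0
    have h1 := (hf.convex y hy).deriv_le_slope (Set.mem_univ 0) (Set.mem_univ 1) one_pos hd
    have h2 := (hf.convex y hy).slope_le_deriv (Set.mem_univ (-1)) (Set.mem_univ 0)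
      (by norm_num) hd
    rw [slope_def_field] at h1 h2
    have h3 := (hf.lipschitz_deriv y hy).dist_le_mul z 0
    rw [Real.dist_eq, Real.dist_eq, sub_zero] at h3
    have h4 : (L : ℝ) * |z| ≤ L * |r| :=
      mul_le_mul_of_nonneg_left (hz.trans (le_abs_self r)) L.2
    have a0 := abs_le.1 ((hC₀ y hy).trans (le_abs_self _))
    have a1 := abs_le.1 ((hC₁ y hy).trans (le_abs_self _))
    have a2 := abs_le.1 ((hC₂ y hy).trans (le_abs_self _))
    have h5 := abs_le.1 (h3.trans h4)
    norm_num at h1 h2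
    have p0 := abs_nonneg C₀
    have p1 := abs_nonneg C₁
    have p2 := abs_nonneg C₂
    rw [abs_le]
    constructor <;> rw [hD] <;> linarith
  have hinc : ∀ y ∈ 𝒴, ∀ z, |z| ≤ r → ∀ w, |w| ≤ r → |f z y - f w y| ≤ D * |z - w| := by
    intro y hy z hz w hw
    have := (convex_Icc (-r) r).norm_image_sub_le_of_norm_deriv_le (f := fun z => f z y) (C := D)
      (x := w) (y := z) (fun u _ => hf.differentiable y hy u)
      (fun u hu => hderiv y hy u (abs_le.2 hu)) (abs_le.1 hw) (abs_le.1 hz)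
    simpa using this
  refine ⟨D + |C₀| + D * |r|, by positivity, fun y hy z hz => ?_⟩
  have hr : 0 ≤ r := (abs_nonneg z).trans hz
  refine ⟨?_, (hderiv y hy z hz).trans (by nlinarith [abs_nonneg C₀, abs_nonneg r]),
    fun w hw => (hinc y hy z hz w hw).trans
      (mul_le_mul_of_nonneg_right (by nlinarith [abs_nonneg C₀, abs_nonneg r]) (abs_nonneg _))⟩
  have h1 := hinc y hy z hz 0 (by simpa using hr)
  rw [sub_zero] at h1
  have h2 : D * |z| ≤ D * |r| := mul_le_mul_of_nonneg_left (hz.trans (le_abs_self r)) hD0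
  have h3 := (hC₀ y hy).trans (le_abs_self _)
  calc |f z y| ≤ |f z y - f 0 y| + |f 0 y| := by
        simpa using abs_add_le (f z y - f 0 y) (f 0 y)
    _ ≤ _ := by linarith

/-- The conjugate of a differentiable convex function at a derivative is attained there. -/
theorem conjugate_deriv {φ : ℝ → ℝ} (hφ : ConvexOn ℝ Set.univ φ) (hd : Differentiable ℝ φ) (z : ℝ) :
    conjugate φ (deriv φ z) = ((deriv φ z * z - φ z : ℝ) : EReal) := by
  refine le_antisymm (iSup_le fun w => ?_) (le_iSup (fun w => ((deriv φ z * w - φ w : ℝ) : EReal)) z)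
  rw [EReal.coe_le_coe_iff]
  -- The graph lies above its tangent at `z`, on either side.
  rcases lt_trichotomy w z with h | rfl | h
  · have := hφ.slope_le_deriv (Set.mem_univ w) (Set.mem_univ z) h (hd z)
    rw [slope_def_field, div_le_iff₀ (by linarith)] at this
    linarith
  · exact le_rfl
  · have := hφ.deriv_le_slope (Set.mem_univ z) (Set.mem_univ w) h (hd z)
    rw [slope_def_field, le_div_iff₀ (by linarith)] at this
    linarith

end Loss

/-! ### Continuity and homogeneity of the regularizer. -/

theorem GroupNorm.continuous_eval {n : ℕ} (R : GroupNorm n) : Continuous R.eval := by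
  refine continuous_finsetSum _ fun g _ => ?_
  have h1 : Continuous (R.groupNorm g) := by
    -- A convex function on a finite-dimensional space is continuous in the interior of its domain.
    have := (R.groupNorm g).convexOn.continuousOn_interior
    rwa [interior_univ, continuousOn_univ] at this
  refine h1.comp (continuous_pi fun i => ?_)
  fun_prop

theorem GroupNorm.eval_smul {n : ℕ} (R : GroupNorm n) (c : ℝ) (b : EuclideanSpace ℝ (Fin n)) :
    R.eval (c • b) = |c| * R.eval b := by
  unfold GroupNorm.eval
  rw [Finset.mul_sum]
  refine Finset.sum_congr rfl fun g _ => ?_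
  rw [← Real.norm_eq_abs, ← map_smul_eq_mul]
  rfl

/-! ### Stationarity of the population objective. -/

section Population

variable {n : ℕ} {Λ : Measure (EuclideanSpace ℝ (Fin n) × ℝ)}
  {f : ℝ → ℝ → ℝ} {𝒴 : Set ℝ} {L : NNReal}

theorem IsSmoothConvexLoss.aemeasurable_loss (hf : IsSmoothConvexLoss f 𝒴 L)
    (h𝒴 : MeasurableSet 𝒴) (hΛ : ∀ᵐ p ∂Λ, p.2 ∈ 𝒴) (b : EuclideanSpace ℝ (Fin n)) :
    AEMeasurable (fun p => f (inner ℝ p.1 b) p.2) Λ := by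
  have h1 : Measurable fun p : EuclideanSpace ℝ (Fin n) × ℝ => ((inner ℝ p.1 b : ℝ), p.2) := by
    fun_prop
  refine ((hf.measurable_uncurry_indicator h𝒴).comp h1).aemeasurable.congr ?_
  filter_upwards [hΛ] with p hp
  simp [hp]

theorem IsSmoothConvexLoss.aemeasurable_deriv (hf : IsSmoothConvexLoss f 𝒴 L)
    (h𝒴 : MeasurableSet 𝒴) (hΛ : ∀ᵐ p ∂Λ, p.2 ∈ 𝒴) (b : EuclideanSpace ℝ (Fin n)) :
    AEMeasurable (fun p => deriv (fun z => f z p.2) (inner ℝ p.1 b)) Λ := by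
  have h1 : Measurable fun p : EuclideanSpace ℝ (Fin n) × ℝ => ((inner ℝ p.1 b : ℝ), p.2) := by
    fun_prop
  refine ((hf.measurable_deriv_indicator h𝒴).comp h1).aemeasurable.congr ?_
  filter_upwards [hΛ] with p hp
  simp [hp]

theorem abs_inner_le_of_norm_le {B : ℝ} {u b : EuclideanSpace ℝ (Fin n)} (hu : ‖u‖ ≤ B) :
    |(inner ℝ u b : ℝ)| ≤ B * ‖b‖ :=
  (abs_real_inner_le_norm u b).trans (mul_le_mul_of_nonneg_right hu (norm_nonneg b))

/-- First order optimality along the ray through the minimizer. -/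
theorem integral_deriv_mul_add_eval_eq_zero [IsProbabilityMeasure Λ]
    (hf : IsSmoothConvexLoss f 𝒴 L) (h𝒴 : MeasurableSet 𝒴) {B : ℝ}
    (hΛ : ∀ᵐ p ∂Λ, ‖p.1‖ ≤ B ∧ p.2 ∈ 𝒴) (R : GroupNorm n) (lam : ℝ)
    {βstar : EuclideanSpace ℝ (Fin n)}
    (hβstar : IsMinOn (objective f Λ lam R) Set.univ βstar) :
    ∫ p, deriv (fun z => f z p.2) (inner ℝ p.1 βstar) * inner ℝ p.1 βstar ∂Λ +
      lam * R.eval βstar = 0 := by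
  have hΛ𝒴 : ∀ᵐ p ∂Λ, p.2 ∈ 𝒴 := hΛ.mono fun _ h => h.2
  have hB : 0 ≤ B := by
    obtain ⟨p, hp, -⟩ := hΛ.exists
    exact (norm_nonneg _).trans hp
  set r := B * ‖βstar‖
  have hr : 0 ≤ r := by positivity
  -- The factor 2 covers scalings `s` in the unit ball around 1, where the dominating function is
  -- needed.
  obtain ⟨K, hK0, hK⟩ := hf.exists_bound (2 * r)
  have hz : ∀ᵐ p ∂Λ, |(inner ℝ p.1 βstar : ℝ)| ≤ r ∧ p.2 ∈ 𝒴 := by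
    filter_upwards [hΛ] with p hp
    exact ⟨abs_inner_le_of_norm_le hp.1, hp.2⟩
  set F : ℝ → EuclideanSpace ℝ (Fin n) × ℝ → ℝ := fun s p =>
    f (inner ℝ p.1 (s • βstar)) p.2 with hF
  set F' : ℝ → EuclideanSpace ℝ (Fin n) × ℝ → ℝ := fun s p =>
    deriv (fun z => f z p.2) (inner ℝ p.1 (s • βstar)) * inner ℝ p.1 βstar with hF'
  have hin : Measurable fun p : EuclideanSpace ℝ (Fin n) × ℝ => (inner ℝ p.1 βstar : ℝ) := by
    fun_prop
  have hd := (hasDerivAt_integral_of_dominated_loc_of_deriv_le (μ := Λ) (F := F) (F' := F')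
    (x₀ := (1 : ℝ)) (bound := fun _ => K * r) (Metric.ball_mem_nhds (1 : ℝ) one_pos)
    (Eventually.of_forall fun s => (hf.aemeasurable_loss h𝒴 hΛ𝒴 _).aestronglyMeasurable)
    (Integrable.of_bound (hf.aemeasurable_loss h𝒴 hΛ𝒴 _).aestronglyMeasurable K (by
      filter_upwards [hz] with p hp
      simp only [hF, one_smul, Real.norm_eq_abs]
      exact (hK p.2 hp.2 _ (hp.1.trans (by linarith))).1))
    ((hf.aemeasurable_deriv h𝒴 hΛ𝒴 _).mul hin.aemeasurable).aestronglyMeasurable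
    (by
      filter_upwards [hz] with p hp s hs
      rw [hF', norm_mul]
      refine mul_le_mul (hK p.2 hp.2 _ ?_).2.1 hp.1 (norm_nonneg _) hK0
      have hs2 : |s| ≤ 2 := by
        rw [Metric.mem_ball, Real.dist_eq, abs_lt] at hs
        exact abs_le.2 ⟨by linarith, by linarith⟩
      rw [real_inner_smul_right, abs_mul]
      exact mul_le_mul hs2 hp.1 (abs_nonneg _) (by norm_num))
    (integrable_const _)
    (by
      filter_upwards [hz] with p hp s _
      have h1 : HasDerivAt (fun s : ℝ => (inner ℝ p.1 (s • βstar) : ℝ)) (inner ℝ p.1 βstar) s := by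
        simp only [real_inner_smul_right]
        simpa using (hasDerivAt_id s).mul_const (inner ℝ p.1 βstar : ℝ)
      exact (hf.differentiable p.2 hp.2 _).hasDerivAt.comp s h1)).2
  have hd2 : HasDerivAt (fun s => ∫ p, F s p ∂Λ + lam * (s * R.eval βstar))
      (∫ p, F' 1 p ∂Λ + lam * R.eval βstar) 1 := by
    have h1 : HasDerivAt (fun s : ℝ => lam * (s * R.eval βstar)) (lam * R.eval βstar) 1 := by
      simpa using ((hasDerivAt_id (1 : ℝ)).mul_const (R.eval βstar)).const_mul lam
    exact hd.add h1
  -- For `s > 0` homogeneity makes the regularizer linear in `s`, so the objective is differentiable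
  -- along the ray and no subgradient of the norm is needed.
  have hmin : IsLocalMin (fun s => ∫ p, F s p ∂Λ + lam * (s * R.eval βstar)) 1 := by
    filter_upwards [lt_mem_nhds (zero_lt_one' ℝ)] with s hs
    have h1 := hβstar (Set.mem_univ (s • βstar))
    simp only [Set.mem_ofPred_eq, objective, R.eval_smul, abs_of_pos hs] at h1
    simpa [hF] using h1
  have := hmin.hasDerivAt_eq_zero hd2
  simpa [hF'] using this

end Population

/-! ### Pathwise analysis of one realization. -/

section Realization

variable {n : ℕ} {f : ℝ → ℝ → ℝ} {𝒴 : Set ℝ} {L : NNReal} {μ : ℕ → ℝ}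
  {x : ℕ → EuclideanSpace ℝ (Fin n)} {y : ℕ → ℝ}

theorem onlineLoss_eq_runningAverage (b : EuclideanSpace ℝ (Fin n)) (t : ℕ) :
    onlineLoss f μ x y b t = runningAverage μ (fun t => f (inner ℝ (x t) b) (y t)) t := by
  induction t with
  | zero => rfl
  | succ t ih =>
    cases t with
    | zero => rfl
    | succ t => simp only [onlineLoss, runningAverage, ih, smul_eq_mul]

theorem onlineCertificate_eq_runningAverage (lam : ℝ) (β : ℕ → EuclideanSpace ℝ (Fin n)) (t : ℕ) :
    onlineCertificate f lam μ x y β t =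
      -(1 / lam) • runningAverage μ (fun t => onlineTheta f x y β t • x t) t := by
  induction t with
  | zero => simp [onlineCertificate, runningAverage]
  | succ t ih =>
    cases t with
    | zero => simp only [onlineCertificate, runningAverage]; module
    | succ t => simp only [onlineCertificate, runningAverage, ih]; module

/-- Each conjugate is evaluated at a derivative of the loss, where it is finite and explicit, so the
extended-real recursion stays real. -/
theorem onlineDual_eq_runningAverage (hf : IsSmoothConvexLoss f 𝒴 L)
    (hy : ∀ t, 1 ≤ t → y t ∈ 𝒴) (β : ℕ → EuclideanSpace ℝ (Fin n)) (t : ℕ) :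
    onlineDual f μ y (onlineTheta f x y β) t =
      ((runningAverage μ (fun t => f (inner ℝ (x t) (β t)) (y t) -
        onlineTheta f x y β t * inner ℝ (x t) (β t)) t : ℝ) : EReal) := by
  have hconj : ∀ t, 1 ≤ t → conjugate (fun z => f z (y t)) (onlineTheta f x y β t) =
      ((onlineTheta f x y β t * inner ℝ (x t) (β t) - f (inner ℝ (x t) (β t)) (y t) : ℝ) : EReal) :=
    fun t ht => conjugate_deriv (hf.convex _ (hy t ht)) (hf.differentiable _ (hy t ht)) _
  induction t with
  | zero => rfl
  | succ t ih =>
    cases t with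
    | zero =>
      simp only [onlineDual, runningAverage]
      rw [hconj 1 le_rfl, ← EReal.coe_neg, neg_sub]
    | succ t =>
      simp only [onlineDual, runningAverage]
      rw [hconj (t + 2) (by omega), ih, ← EReal.coe_mul, ← EReal.coe_neg, ← EReal.coe_mul,
        ← EReal.coe_add]
      congr 1
      simp only [smul_eq_mul]
      ring

variable {B : ℝ} {b : EuclideanSpace ℝ (Fin n)} {β : ℕ → EuclideanSpace ℝ (Fin n)}

theorem tendsto_inner_sub (hx : ∀ t, 1 ≤ t → ‖x t‖ ≤ B) (hβ : Tendsto β atTop (𝓝 b)) :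
    Tendsto (fun t => (inner ℝ (x t) (β t) - inner ℝ (x t) b : ℝ)) atTop (𝓝 0) := by
  have h := (tendsto_iff_norm_sub_tendsto_zero.1 hβ).const_mul B
  rw [mul_zero] at h
  refine squeeze_zero_norm' ?_ h
  filter_upwards [eventually_ge_atTop 1] with t ht
  rw [← inner_sub_right]
  exact abs_inner_le_of_norm_le (hx t ht)

theorem tendsto_onlineTheta_sub (hf : IsSmoothConvexLoss f 𝒴 L) (hx : ∀ t, 1 ≤ t → ‖x t‖ ≤ B)
    (hy : ∀ t, 1 ≤ t → y t ∈ 𝒴) (hβ : Tendsto β atTop (𝓝 b)) :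
    Tendsto (fun t => onlineTheta f x y β t - onlineTheta f x y (fun _ => b) t) atTop (𝓝 0) := by
  have h := (tendsto_inner_sub hx hβ).norm.const_mul (L : ℝ)
  rw [norm_zero, mul_zero] at h
  refine squeeze_zero_norm' ?_ h
  filter_upwards [eventually_ge_atTop 1] with t ht
  exact (hf.lipschitz_deriv (y t) (hy t ht)).norm_sub_le _ _

/-- The bound is uniform in `s` because the online loss at time `t` evaluates all earlier samples at
the current point. -/
theorem eventually_abs_inner_le (hx : ∀ t, 1 ≤ t → ‖x t‖ ≤ B) (hβ : Tendsto β atTop (𝓝 b)) :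
    ∀ᶠ t in atTop, ∀ s, 1 ≤ s → |(inner ℝ (x s) (β t) : ℝ)| ≤ B * (‖b‖ + 1) := by
  filter_upwards [hβ.norm.eventually_le_const (lt_add_one ‖b‖)] with t ht s hs
  exact (abs_inner_le_of_norm_le (hx s hs)).trans
    (mul_le_mul_of_nonneg_left ht ((norm_nonneg _).trans (hx s hs)))

theorem abs_inner_le (hx : ∀ t, 1 ≤ t → ‖x t‖ ≤ B) (s : ℕ) (hs : 1 ≤ s) :
    |(inner ℝ (x s) b : ℝ)| ≤ B * (‖b‖ + 1) :=
  (abs_inner_le_of_norm_le (hx s hs)).trans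
    (mul_le_mul_of_nonneg_left (by linarith) ((norm_nonneg _).trans (hx s hs)))

theorem tendsto_loss_sub (hf : IsSmoothConvexLoss f 𝒴 L) (hx : ∀ t, 1 ≤ t → ‖x t‖ ≤ B)
    (hy : ∀ t, 1 ≤ t → y t ∈ 𝒴) (hβ : Tendsto β atTop (𝓝 b)) :
    Tendsto (fun t => f (inner ℝ (x t) (β t)) (y t) - f (inner ℝ (x t) b) (y t)) atTop (𝓝 0) := by
  obtain ⟨K, -, hK⟩ := hf.exists_bound (B * (‖b‖ + 1))
  have h := (tendsto_inner_sub hx hβ).norm.const_mul K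
  rw [norm_zero, mul_zero] at h
  refine squeeze_zero_norm' ?_ h
  filter_upwards [eventually_ge_atTop 1, eventually_abs_inner_le hx hβ] with t ht hz
  exact (hK (y t) (hy t ht) _ (hz t ht)).2.2 _ (abs_inner_le hx t ht)

theorem tendsto_mul_sub_mul {u v w z : ℕ → ℝ} {C D : ℝ}
    (huv : Tendsto (fun t => u t - v t) atTop (𝓝 0)) (hwz : Tendsto (fun t => w t - z t) atTop (𝓝 0))
    (hw : ∀ᶠ t in atTop, |w t| ≤ C) (hv : ∀ᶠ t in atTop, |v t| ≤ D) :
    Tendsto (fun t => u t * w t - v t * z t) atTop (𝓝 0) := by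
  have h := (huv.norm.mul_const C).add (hwz.norm.const_mul D)
  rw [norm_zero, zero_mul, mul_zero, add_zero] at h
  refine squeeze_zero_norm' ?_ h
  filter_upwards [hw, hv] with t hwt hvt
  have : u t * w t - v t * z t = (u t - v t) * w t + v t * (w t - z t) := by ring
  rw [this]
  refine (norm_add_le _ _).trans ?_
  rw [norm_mul, norm_mul]
  exact add_le_add (mul_le_mul_of_nonneg_left hwt (norm_nonneg _))
    (mul_le_mul_of_nonneg_right hvt (norm_nonneg _))

/-- The online loss is asymptotically insensitive to vanishing perturbations of its argument. -/
theorem tendsto_onlineLoss (hf : IsSmoothConvexLoss f 𝒴 L)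
    (hμ : ∀ t, 2 ≤ t → μ t ∈ Set.Ioo (0 : ℝ) 1) (hx : ∀ t, 1 ≤ t → ‖x t‖ ≤ B)
    (hy : ∀ t, 1 ≤ t → y t ∈ 𝒴) (hβ : Tendsto β atTop (𝓝 b)) {l : ℝ}
    (hl : Tendsto (runningAverage μ fun t => f (inner ℝ (x t) b) (y t)) atTop (𝓝 l)) :
    Tendsto (fun t => onlineLoss f μ x y (β t) t) atTop (𝓝 l) := by
  obtain ⟨K, hK0, hK⟩ := hf.exists_bound (B * (‖b‖ + 1))
  have hB : 0 ≤ B := (norm_nonneg _).trans (hx 1 le_rfl)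
  have h0 : Tendsto (fun t => onlineLoss f μ x y (β t) t - onlineLoss f μ x y b t) atTop (𝓝 0) := by
    have h := (tendsto_iff_norm_sub_tendsto_zero.1 hβ).const_mul (K * B)
    rw [mul_zero] at h
    refine squeeze_zero_norm' ?_ h
    filter_upwards [eventually_abs_inner_le hx hβ] with t hz
    rw [onlineLoss_eq_runningAverage, onlineLoss_eq_runningAverage, sub_eq_iff_eq_add.2
      ((runningAverage_congr (fun s _ => (sub_add_cancel _ _).symm) t).trans
        (runningAverage_add (fun s => f (inner ℝ (x s) (β t)) (y s) - f (inner ℝ (x s) b) (y s))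
          (fun s => f (inner ℝ (x s) b) (y s)) t))]
    -- Every averaged increment is at most `K * B * ‖β t - b‖`, uniformly in `s`, and averaging
    -- preserves this bound.
    refine norm_runningAverage_le hμ (by positivity) (fun s hs => ?_) t
    refine ((hK (y s) (hy s hs) _ (hz s hs)).2.2 _ (abs_inner_le hx s hs)).trans ?_
    rw [← inner_sub_right, mul_assoc]
    exact mul_le_mul_of_nonneg_left (abs_inner_le_of_norm_le (hx s hs)) hK0
  have h := h0.add hl
  rw [zero_add] at h
  refine h.congr fun t => ?_
  rw [onlineLoss_eq_runningAverage b]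
  ring

end Realization

end OnlineScreening

/-! ### Conclusion: the almost sure limits combined. -/

theorem proposition3p2 {n : ℕ}
    -- the law of the data, supported on a compact product
    (Λ : Measure (EuclideanSpace ℝ (Fin n) × ℝ)) [IsProbabilityMeasure Λ]
    (𝒳 : Set (EuclideanSpace ℝ (Fin n))) (𝒴 : Set ℝ) (h𝒳 : IsCompact 𝒳) (h𝒴 : IsCompact 𝒴)
    (hΛ : ∀ᵐ p ∂Λ, p ∈ 𝒳 ×ˢ 𝒴)
    -- the loss and the regularizer
    (f : ℝ → ℝ → ℝ) (L : NNReal) (hf : OnlineScreening.IsSmoothConvexLoss f 𝒴 L)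
    (R : OnlineScreening.GroupNorm n) (lam : ℝ) (hlam : 0 < lam)
    -- the averaging weights
    (μ : ℕ → ℝ) (hμ : ∀ t, 2 ≤ t → μ t ∈ Set.Ioo (0 : ℝ) 1)
    (hμ_sum : Tendsto (fun T => ∑ t ∈ Finset.Icc 1 T, μ t) atTop atTop)
    (hμ_sq : Summable (fun t => μ t ^ 2))
    -- the samples and the iterates of the online algorithm
    {S : Type*} [mS : MeasurableSpace S] (P : Measure S) [IsProbabilityMeasure P]
    (ℱ : Filtration ℕ mS) (x : ℕ → S → EuclideanSpace ℝ (Fin n)) (y : ℕ → S → ℝ)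
    (β : ℕ → S → EuclideanSpace ℝ (Fin n)) (hscheme : OnlineScreening.IsOnlineScheme P ℱ Λ x y β)
    -- the minimizer, and convergence of the iterates
    (βstar : EuclideanSpace ℝ (Fin n))
    (hβstar : IsMinOn (OnlineScreening.objective f Λ lam R) Set.univ βstar)
    (hconv : ∀ᵐ ω ∂P, Tendsto (fun t => β t ω) atTop (𝓝 βstar)) :
    ∀ᵐ ω ∂P,
      Tendsto (OnlineScreening.onlineCertificate f lam μ (fun t => x t ω) (fun t => y t ω)
          (fun t => β t ω)) atTop (𝓝 (OnlineScreening.certificate f Λ lam βstar)) ∧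
      ∀ βbar : ℕ → EuclideanSpace ℝ (Fin n), Tendsto βbar atTop (𝓝 βstar) →
        Tendsto (fun t => OnlineScreening.onlineGap f lam R μ (fun t => x t ω) (fun t => y t ω)
          (fun t => β t ω) t (βbar t)) atTop (𝓝 (0 : EReal)) := by
  have hΛ𝒴 : ∀ᵐ p ∂Λ, p.2 ∈ 𝒴 := hΛ.mono fun _ h => h.2
  have h𝒴m := h𝒴.measurableSet
  obtain ⟨B, hB⟩ := h𝒳.isBounded.exists_norm_le
  have hbd : ∀ᵐ p ∂Λ, ‖p.1‖ ≤ B ∧ p.2 ∈ 𝒴 := hΛ.mono fun p h => ⟨hB _ h.1, h.2⟩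
  obtain ⟨K, hK0, hK⟩ := hf.exists_bound (B * ‖βstar‖)
  have hin : Measurable fun p : EuclideanSpace ℝ (Fin n) × ℝ => (inner ℝ p.1 βstar : ℝ) := by
    fun_prop
  have hlm := hf.aemeasurable_loss h𝒴m hΛ𝒴 βstar
  have hdm := hf.aemeasurable_deriv h𝒴m hΛ𝒴 βstar
  have hlK : ∀ᵐ p ∂Λ, |f (inner ℝ p.1 βstar) p.2| ≤ K := hbd.mono fun p hp =>
    (hK p.2 hp.2 _ (OnlineScreening.abs_inner_le_of_norm_le hp.1)).1
  have hdK : ∀ᵐ p ∂Λ, |deriv (fun z => f z p.2) (inner ℝ p.1 βstar)| ≤ K := hbd.mono fun p hp =>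
    (hK p.2 hp.2 _ (OnlineScreening.abs_inner_le_of_norm_le hp.1)).2.1
  have hdinm : AEMeasurable (fun p : EuclideanSpace ℝ (Fin n) × ℝ =>
      deriv (fun z => f z p.2) (inner ℝ p.1 βstar) * inner ℝ p.1 βstar) Λ :=
    hdm.mul hin.aemeasurable
  have hdinK : ∀ᵐ p ∂Λ, |deriv (fun z => f z p.2) (inner ℝ p.1 βstar) * inner ℝ p.1 βstar| ≤
      K * (B * ‖βstar‖) := by
    filter_upwards [hbd, hdK] with p hp hp'
    rw [abs_mul]
    exact mul_le_mul hp' (OnlineScreening.abs_inner_le_of_norm_le hp.1) (abs_nonneg _) hK0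
  have hopt := OnlineScreening.integral_deriv_mul_add_eval_eq_zero hf h𝒴m hbd R lam hβstar
  -- Stationarity identifies the limit of the dual values with the optimal primal value.
  have hdual_int : ∫ p, (f (inner ℝ p.1 βstar) p.2 -
      deriv (fun z => f z p.2) (inner ℝ p.1 βstar) * inner ℝ p.1 βstar) ∂Λ =
      ∫ p, f (inner ℝ p.1 βstar) p.2 ∂Λ + lam * R.eval βstar := by
    rw [integral_sub (Integrable.of_bound hlm.aestronglyMeasurable K hlK)
      (Integrable.of_bound hdinm.aestronglyMeasurable _ hdinK)]
    linarith
  -- The exceptional null set is fixed before `βbar` is chosen, so `βbar` may depend on the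
  -- realization.
  filter_upwards [hconv, hscheme.ae_forall_sample hbd,
    hscheme.ae_tendsto_runningAverage hμ hμ_sum hμ_sq hlm hlK,
    hscheme.ae_tendsto_runningAverage hμ hμ_sum hμ_sq (hlm.sub hdinm)
      (C := K + K * (B * ‖βstar‖)) (by
        filter_upwards [hlK, hdinK] with p h1 h2
        exact (abs_sub _ _).trans (add_le_add h1 h2)),
    hscheme.ae_tendsto_runningAverage_vector hμ hμ_sum hμ_sq
      (hdm.smul measurable_fst.aemeasurable) (C := K * B) (by
        filter_upwards [hbd, hdK] with p h1 h2
        rw [Pi.smul_apply', norm_smul]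
        exact mul_le_mul h2 h1.1 (norm_nonneg _) hK0)]
    with ω hβ hsample hloss hdual hcert
  have hx : ∀ t, 1 ≤ t → ‖x t ω‖ ≤ B := fun t ht => (hsample t ht).1
  have hy : ∀ t, 1 ≤ t → y t ω ∈ 𝒴 := fun t ht => (hsample t ht).2
  have hθ := OnlineScreening.tendsto_onlineTheta_sub hf hx hy hβ
  have hθK : ∀ᶠ t in atTop, |OnlineScreening.onlineTheta f (fun t => x t ω) (fun t => y t ω)
      (fun _ => βstar) t| ≤ K := by
    filter_upwards [eventually_ge_atTop 1] with t ht
    exact (hK _ (hy t ht) _ (OnlineScreening.abs_inner_le_of_norm_le (hx t ht))).2.1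
  refine ⟨?_, fun βbar hβbar => ?_⟩
  · have hlim := OnlineScreening.tendsto_runningAverage_of_sub hμ hμ_sum
      (u := fun t => OnlineScreening.onlineTheta f (fun t => x t ω) (fun t => y t ω)
        (fun t => β t ω) t • x t ω) hcert (by
        have h := hθ.norm.mul_const B
        rw [norm_zero, zero_mul] at h
        refine squeeze_zero_norm' ?_ h
        filter_upwards [eventually_ge_atTop 1] with t ht
        rw [Pi.smul_apply', ← sub_smul (M := EuclideanSpace ℝ (Fin n)), norm_smul]
        exact mul_le_mul_of_nonneg_left (hx t ht) (norm_nonneg _))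
    exact (hlim.const_smul (-(1 / lam))).congr fun t =>
      (OnlineScreening.onlineCertificate_eq_runningAverage lam _ t).symm
  · have hF := OnlineScreening.tendsto_onlineLoss hf hμ hx hy hβbar hloss
    have hD := OnlineScreening.tendsto_runningAverage_of_sub hμ hμ_sum
      (u := fun t => f (inner ℝ (x t ω) (β t ω)) (y t ω) -
        OnlineScreening.onlineTheta f (fun t => x t ω) (fun t => y t ω) (fun t => β t ω) t *
          inner ℝ (x t ω) (β t ω)) hdual (by
        have h := (OnlineScreening.tendsto_loss_sub hf hx hy hβ).sub
          (OnlineScreening.tendsto_mul_sub_mul hθ (OnlineScreening.tendsto_inner_sub hx hβ)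
            (by
              filter_upwards [OnlineScreening.eventually_abs_inner_le hx hβ,
                eventually_ge_atTop 1] with t h1 ht
              exact h1 t ht) hθK)
        rw [sub_zero] at h
        refine h.congr fun t => ?_
        simp only [OnlineScreening.onlineTheta, Pi.sub_apply]
        ring)
    have hΩ := ((R.continuous_eval.tendsto βstar).comp hβbar).const_mul lam
    have hgap := (hF.add hΩ).sub hD
    simp only [Pi.sub_apply] at hgap
    rw [hdual_int, sub_self] at hgap
    refine ((continuous_coe_real_ereal.tendsto 0).comp hgap).congr fun t => ?_
    rw [OnlineScreening.onlineGap, OnlineScreening.onlineDual_eq_runningAverage hf hy,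
      OnlineScreening.onlinePrimal]
    rfl
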